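/- Let $r\ge 1$ and $a\ge 0$ be coprime integers, $\varepsilon=e^{2\pi i/r}$, and let $G=\frac1r(1,a)\subset \mathrm{GL}(2,\mathbb C)$ be the cyclic group generated by $\mathrm{diag}(\varepsilon,\varepsilon^a)$. For a monomial $X$ in $x,y$ let $\mathrm{wt}(X)$ be the character of $G$ with $X(g\cdot p)=\mathrm{wt}(X)(g)\,X(p)$ for all $g\in G$, $p\in\mathbb C^2$, and let $\chi_i$ be the character that takes the value $\varepsilon^i$ on the generator. A $G$-graph is a set $\Gamma$ of monomials that is the complement, in the set of all monomials, of a monomial ideal of $\mathbb C[x,y]$ and on which $\mathrm{wt}:\Gamma\to G^\vee$ is bijective; a socle of $\Gamma$ is an element of $\Gamma$ that divides no other element of $\Gamma$. Let $\mathrm{EC}$ be the set of characters $\mathrm{wt}(X)$, with $X$ a socle of some $G$-graph, and $\mathrm{EC}(i)=\{\chi_i\otimes\chi\mid\chi\in\mathrm{EC}\}$. Let $\pi:Y\to\mathbb C^2/G$ be the minimal resolution. A character $\chi$ is called special (in the sense of Wunram) if $H^1(Y,\widetilde M_\chi^\vee)=0$, where $M_\chi=\{f\in\mathbb C[x,y]\mid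 f(g\cdot p)=\chi(g)f(p)\text{ for all }g\in G,\ p\in\mathbb C^2\}$, $\widetilde M_\chi=\pi^*M_\chi/\mathrm{torsion}$ and $\widetilde M_\chi^\vee=\mathcal Hom(\widetilde M_\chi,\mathcal O_Y)$. Then for every $G$-graph $\Gamma$ and every socle $X$ of $\Gamma$ the character $\mathrm{wt}(X\cdot xy)$ is special; that is, every character in $\mathrm{EC}(1+a)$ is special. -/

import Mathlib

namespace CyclicQuotient

noncomputable section

/-! ## The group `1/r(1,a)`, its characters and the weights of monomials -/

/-- `ε = exp(2πi/r)`, a primitive `r`-th root of unity for `r ≥ 1`. -/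
def eps (r : ℕ) : ℂ := Complex.exp (2 * Real.pi * Complex.I / r)

/-- The diagonal matrix `diag(ε, ε^a)`. -/
def gen (r a : ℕ) : GL (Fin 2) ℂ :=
  Matrix.GeneralLinearGroup.mkOfDetNeZero !![eps r, 0; 0, eps r ^ a]
    (by simp [Matrix.det_fin_two, eps, Complex.exp_ne_zero])

/-- The group `G = 1/r(1,a)`, i.e. the cyclic subgroup of `GL(2,ℂ)` generated by
`diag(ε, ε^a)`. -/
def grp (r a : ℕ) : Subgroup (GL (Fin 2) ℂ) := Subgroup.zpowers (gen r a)

/-- Characters of `G`, equivalently isomorphism classes of irreducible representations. -/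
abbrev Character (r a : ℕ) : Type := grp r a →* ℂˣ

theorem grp_diag {r a : ℕ} {g : GL (Fin 2) ℂ} (hg : g ∈ grp r a) :
    g.val 0 1 = 0 ∧ g.val 1 0 = 0 := by
  rw [grp, Subgroup.zpowers_eq_closure] at hg
  induction hg using Subgroup.closure_induction with
  | mem x hx => rw [Set.mem_singleton_iff] at hx; subst hx; simp [gen]
  | one => simp
  | mul x y _ _ hx hy => simp [Matrix.mul_apply, Fin.sum_univ_two, hx, hy]
  | inv x _ hx => simp [Matrix.inv_def, Matrix.adjugate_fin_two, hx]

/-- The `i`-th diagonal entry of the elements of `G`, as a character of `G`. -/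
def coordChar (r a : ℕ) (i : Fin 2) : Character r a :=
  MonoidHom.toHomUnits
    { toFun := fun g => g.val.val i i
      map_one' := by simp
      map_mul' := by
        intro g h
        have h1 := grp_diag g.2
        have h2 := grp_diag h.2
        fin_cases i <;> simp [Matrix.mul_apply, Fin.sum_univ_two, h1, h2] }

/-- The character `χ_i` of `G`, determined by `χ_i(g) = ε^i` for the generator `g`. -/
def chi (r a : ℕ) (i : ℕ) : Character r a := coordChar r a 0 ^ i

theorem chi_gen (r a i : ℕ) :
    ((chi r a i ⟨gen r a, Subgroup.mem_zpowers _⟩ : ℂˣ) : ℂ) = eps r ^ i := by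
  simp [chi, coordChar, gen]

/-- The polynomial `f ∈ ℂ[x,y]` is semi-invariant with character `χ`:
`f(g·p) = χ(g) f(p)` for all `g ∈ G` and `p ∈ ℂ²`. -/
def HasWeight {r a : ℕ} (f : MvPolynomial (Fin 2) ℂ) (χ : Character r a) : Prop :=
  ∀ (g : grp r a) (p : Fin 2 → ℂ),
    MvPolynomial.eval (g.val.val.mulVec p) f = (χ g : ℂ) * MvPolynomial.eval p f

/-- The exponents `u = (u₀, u₁)` of the monomials `x^{u₀} y^{u₁}` of `ℂ[x,y]`. -/
abbrev Mon : Type := Fin 2 →₀ ℕ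

/-- The monomial `x^{u₀} y^{u₁}`. -/
def mono (u : Mon) : MvPolynomial (Fin 2) ℂ := MvPolynomial.monomial u 1

/-- The weight of the monomial with exponent `u`: the character of `G` through which `G` acts
on it (see `hasWeight_mono_iff`). -/
def wt (r a : ℕ) (u : Mon) : Character r a := coordChar r a 0 ^ u 0 * coordChar r a 1 ^ u 1

theorem hasWeight_mono_iff {r a : ℕ} (u : Mon) (χ : Character r a) :
    HasWeight (mono u) χ ↔ χ = wt r a u := by
  have key : HasWeight (mono u) (wt r a u) := by
    intro g p
    have h := grp_diag g.2
    simp [mono, MvPolynomial.eval_monomial, Finsupp.prod_fintype, Fin.prod_univ_two, wt, coordChar,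
      h]
    ring
  refine ⟨fun h => ?_, fun h => h ▸ key⟩
  ext g
  have h1 := h g 1
  have h2 := key g 1
  have h3 : MvPolynomial.eval (1 : Fin 2 → ℂ) (mono u) = 1 := by
    simp [mono, MvPolynomial.eval_monomial, Finsupp.prod_fintype]
  rw [h3, mul_one] at h1 h2
  exact h1.symm.trans h2

/-! ## `G`-graphs, socles and essential characters -/

/-- A monomial ideal of `ℂ[x,y]`: an ideal generated by monomials. -/
def IsMonomialIdeal (I : Ideal (MvPolynomial (Fin 2) ℂ)) : Prop :=
  ∃ A : Set Mon, I = Ideal.span (mono '' A)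

/-- A set `Γ` of monomials is a `G`-graph if it is the set of monomials outside some monomial
ideal and the weight map `Γ → G^∨` is bijective. -/
def IsGGraph (r a : ℕ) (Γ : Set Mon) : Prop :=
  (∃ I, IsMonomialIdeal I ∧ Γ = {u | mono u ∉ I}) ∧ Set.BijOn (wt r a) Γ Set.univ

/-- `X` is a socle of `Γ`: it lies in `Γ` and divides no other element of `Γ`. -/
def IsSocle (Γ : Set Mon) (X : Mon) : Prop :=
  X ∈ Γ ∧ ∀ Y ∈ Γ, mono X ∣ mono Y → Y = X

/-- The exponent of the monomial `xy`. -/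
def xy : Mon := Finsupp.single 0 1 + Finsupp.single 1 1

/-- The set `EC` of essential characters: the weights of socles of `G`-graphs. -/
def essentialCharacters (r a : ℕ) : Set (Character r a) :=
  {χ | ∃ Γ X, IsGGraph r a Γ ∧ IsSocle Γ X ∧ χ = wt r a X}

/-- The set `EC(i) = {χ_i ⊗ χ | χ ∈ EC}`. -/
def EC (r a : ℕ) (i : ℕ) : Set (Character r a) :=
  {ψ | ∃ χ ∈ essentialCharacters r a, ψ = chi r a i * χ}

/-! ## The minimal resolution of `ℂ²/G` -/

/-- The lattice `N = ℤ² + ℤ·(1/r, a/r)`; the quotient `ℂ²/G` is the affine toric surface of the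
first quadrant with respect to `N`. -/
def latticeN (r a : ℕ) : AddSubgroup (ℚ × ℚ) :=
  AddSubgroup.closure {(1, 0), (0, 1), ((1 : ℚ) / r, (a : ℚ) / r)}

/-- The standard pairing of an exponent of a Laurent monomial with a vector. -/
def pairing (m : ℤ × ℤ) (v : ℚ × ℚ) : ℚ := m.1 * v.1 + m.2 * v.2

/-- The lattice `M ⊆ ℤ²` dual to `N` (the exponents of the `G`-invariant Laurent monomials). -/
def latticeM (r a : ℕ) : Set (ℤ × ℤ) := {m | ∀ v ∈ latticeN r a, ∃ z : ℤ, pairing m v = z}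

/-- The fan of the minimal resolution `Y → ℂ²/G`: a subdivision of the first quadrant by vectors
`ray 0 = e₂, ray 1, …, ray n = e₁` of `N`, listed clockwise, into `n` cones
`⟨ray k, ray (k+1)⟩`, each generated by a `ℤ`-basis of `N` (so that `Y` is smooth), in which no
interior vector is the sum of its two neighbours (so that no exceptional curve has
self-intersection `-1`). Values of `ray` beyond `n` are irrelevant. -/
structure MinimalResolution (r a : ℕ) where
  n : ℕ
  ray : ℕ → ℚ × ℚ
  ray_zero : ray 0 = (0, 1)
  ray_last : ray n = (1, 0)
  nonneg : ∀ k ≤ n, 0 ≤ (ray k).1 ∧ 0 ≤ (ray k).2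
  clockwise : ∀ k < n, 0 < (ray (k + 1)).1 * (ray k).2 - (ray k).1 * (ray (k + 1)).2
  smooth : ∀ k < n, AddSubgroup.closure {ray k, ray (k + 1)} = latticeN r a
  minimal : ∀ k, k + 2 ≤ n → ray k + ray (k + 2) ≠ ray (k + 1)

/-- The ring `ℂ[x^{±1}, y^{±1}]` of Laurent polynomials. The coordinate rings of all toric charts
of `Y` are subrings of it. -/
abbrev Laurent : Type := AddMonoidAlgebra ℂ (ℤ × ℤ)

/-- The inclusion of `ℂ[x,y]` into the Laurent polynomials. -/
def toLaurent : MvPolynomial (Fin 2) ℂ →ₐ[ℂ] Laurent :=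
  MvPolynomial.aeval
    ![AddMonoidAlgebra.single ((1 : ℤ), (0 : ℤ)) (1 : ℂ),
      AddMonoidAlgebra.single ((0 : ℤ), (1 : ℤ)) (1 : ℂ)]

variable {r a : ℕ}

theorem latticeN_snd_zero (hr : 0 < r) (hra : Nat.gcd r a = 1) {v : ℚ × ℚ}
    (hv : v ∈ latticeN r a) (h0 : v.2 = 0) : ∃ z : ℤ, v.1 = z := by
  have hr' : (r : ℚ) ≠ 0 := by positivity
  have key : ∃ s t k : ℤ, v.1 * r = s * r + k ∧ v.2 * r = t * r + k * a := by
    unfold latticeN at hv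
    clear h0
    induction hv using AddSubgroup.closure_induction with
    | mem x hx =>
      rcases hx with rfl | rfl | rfl
      · exact ⟨1, 0, 0, by simp, by simp⟩
      · exact ⟨0, 1, 0, by simp, by simp⟩
      · exact ⟨0, 0, 1, by field_simp; simp, by field_simp; simp⟩
    | zero => exact ⟨0, 0, 0, by simp, by simp⟩
    | add x y _ _ hx hy =>
      obtain ⟨s, t, k, h1, h2⟩ := hx
      obtain ⟨s', t', k', h1', h2'⟩ := hy
      refine ⟨s + s', t + t', k + k', ?_, ?_⟩ <;>
        simp only [Prod.fst_add, Prod.snd_add, add_mul, h1, h2, h1', h2'] <;> push_cast <;> ring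
    | neg x _ hx =>
      obtain ⟨s, t, k, h1, h2⟩ := hx
      refine ⟨-s, -t, -k, ?_, ?_⟩ <;>
        simp only [Prod.fst_neg, Prod.snd_neg, neg_mul, h1, h2] <;> push_cast <;> ring
  obtain ⟨s, t, k, h1, h2⟩ := key
  rw [h0, zero_mul] at h2
  have h3 : t * (r : ℤ) + k * a = 0 := by exact_mod_cast h2.symm
  have h4 : (r : ℤ) ∣ k * a := ⟨-t, by linarith⟩
  have h5 : (r : ℤ) ∣ k :=
    (Int.isCoprime_iff_gcd_eq_one.2 (by simpa using hra)).dvd_of_dvd_mul_right h4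
  obtain ⟨c, rfl⟩ := h5
  refine ⟨s + c, ?_⟩
  apply mul_right_cancel₀ hr'
  rw [h1]; push_cast; ring

/-- The Hirzebruch-Jung algorithm, from two consecutive vectors `u`, `v` onwards. -/
theorem exists_chain (hr : 0 < r) (hra : Nat.gcd r a = 1) (q : ℕ) :
    ∀ (p : ℕ) (u v : ℚ × ℚ), q < p → u.2 = p / r → v.2 = q / r → 0 ≤ u.1 → u.1 ≤ v.1 →
      0 < v.1 * u.2 - u.1 * v.2 → AddSubgroup.closure {u, v} = latticeN r a →
      ∃ (n : ℕ) (ray : ℕ → ℚ × ℚ), ray 0 = u ∧ ray 1 = v ∧ ray (n + 1) = (1, 0) ∧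
        (∀ k ≤ n + 1, 0 ≤ (ray k).1 ∧ 0 ≤ (ray k).2) ∧
        (∀ k < n + 1, 0 < (ray (k + 1)).1 * (ray k).2 - (ray k).1 * (ray (k + 1)).2) ∧
        (∀ k < n + 1, AddSubgroup.closure {ray k, ray (k + 1)} = latticeN r a) ∧
        ∀ k, k + 2 ≤ n + 1 → ray k + ray (k + 2) ≠ ray (k + 1) := by
  have hr' : (0 : ℚ) < r := by positivity
  induction q using Nat.strong_induction_on with
  | _ q ih =>
  intro p u v hqp hu hv hu0 huv hdet hcl
  have hu2 : 0 ≤ u.2 := by rw [hu]; positivity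
  have hv2 : 0 ≤ v.2 := by rw [hv]; positivity
  rcases Nat.eq_zero_or_pos q with rfl | hq
  · have hv0 : v.2 = 0 := by simpa using hv
    have hp : (0 : ℚ) < p := by exact_mod_cast hqp
    have hu2' : 0 < u.2 := by rw [hu]; positivity
    have hv1 : v = (1, 0) := by
      have h1 : ((1 : ℚ), (0 : ℚ)) ∈ latticeN r a :=
        AddSubgroup.subset_closure (by simp)
      rw [← hcl, AddSubgroup.mem_closure_pair] at h1
      obtain ⟨m, n, hmn⟩ := h1
      have e1 := congrArg Prod.fst hmn
      have e2 := congrArg Prod.snd hmn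
      simp only [Prod.fst_add, Prod.snd_add, Prod.smul_fst, Prod.smul_snd, hv0, smul_zero,
        add_zero] at e1 e2
      rw [zsmul_eq_mul] at e2
      rw [zsmul_eq_mul, zsmul_eq_mul] at e1
      have hm : (m : ℚ) = 0 := (mul_eq_zero.1 e2).resolve_right hu2'.ne'
      rw [hm, zero_mul, zero_add] at e1
      obtain ⟨z, hz⟩ := latticeN_snd_zero hr hra
        (hcl ▸ AddSubgroup.subset_closure (by simp) : v ∈ latticeN r a) hv0
      rw [hz] at e1
      have e3 : n * z = 1 := by exact_mod_cast e1
      have hz0 : 0 ≤ z := by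
        have : (0 : ℚ) ≤ z := hz ▸ hu0.trans huv
        exact_mod_cast this
      have hz1 : z = 1 := by
        rcases Int.eq_one_or_neg_one_of_mul_eq_one' e3 with h | h <;> omega
      exact Prod.ext (by rw [hz, hz1]; simp) hv0
    refine ⟨0, fun k => if k = 0 then u else v, by simp, by simp, by simpa using hv1, ?_, ?_, ?_,
      ?_⟩
    · intro k _
      by_cases h : k = 0
      · simp [h, hu0, hu2]
      · simp [h, hu0.trans huv, hv2]
    · intro k hk
      obtain rfl : k = 0 := by omega
      simpa using hdet
    · intro k hk
      obtain rfl : k = 0 := by omega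
      simpa using hcl
    · intro k hk; omega
  · -- the next vector is `b v - u` with `b = ⌈p / q⌉ ≥ 2`
    obtain ⟨b, q', hb, hq', hbq⟩ : ∃ b q' : ℕ, 2 ≤ b ∧ q' < q ∧ b * q = p + q' := by
      refine ⟨(p + q - 1) / q, (p + q - 1) / q * q - p, ?_, ?_, ?_⟩
      · rw [Nat.le_div_iff_mul_le hq]; omega
      · have := Nat.div_mul_le_self (p + q - 1) q; omega
      · have := Nat.lt_div_mul_add (a := p + q - 1) hq
        omega
    have hbq' : (b : ℚ) * q = p + q' := by exact_mod_cast hbq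
    have hb' : (2 : ℚ) ≤ b := by exact_mod_cast hb
    set w : ℚ × ℚ := (b * v.1 - u.1, b * v.2 - u.2) with hw
    have hcl' : AddSubgroup.closure {v, w} = latticeN r a := by
      rw [← hcl]
      have hwe : w = b • v - u := by ext <;> simp [hw]
      apply le_antisymm <;> rw [AddSubgroup.closure_le]
      · rintro x (rfl | rfl)
        · exact AddSubgroup.subset_closure (by simp)
        · rw [hwe]
          exact sub_mem (nsmul_mem (AddSubgroup.subset_closure (by simp)) _)
            (AddSubgroup.subset_closure (by simp))
      · rintro x (rfl | rfl)
        · have : x = b • v - w := by rw [hwe]; abel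
          rw [this]
          exact sub_mem (nsmul_mem (AddSubgroup.subset_closure (by simp)) _)
            (AddSubgroup.subset_closure (by simp))
        · exact AddSubgroup.subset_closure (by simp)
    have hv1 : 0 ≤ v.1 := hu0.trans huv
    obtain ⟨n, ray, h0, h1, hl, hnn, hcw, hsm, hmin⟩ := ih q' hq' q v w hq' hv
      (by simp only [hw, hu, hv]; field_simp; linarith) hv1
      (by simp only [hw]; nlinarith) (by simp only [hw]; nlinarith) hcl'
    refine ⟨n + 1, fun k => Nat.casesOn k u ray, rfl, h0, hl, ?_, ?_, ?_, ?_⟩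
    · rintro (_ | k) hk
      · exact ⟨hu0, hu2⟩
      · exact hnn k (by omega)
    · rintro (_ | k) hk
      · simpa [h0] using hdet
      · exact hcw k (by omega)
    · rintro (_ | k) hk
      · simpa [h0] using hcl
      · exact hsm k (by omega)
    · rintro (_ | k) hk
      · simp only [zero_add, h0, h1]
        intro h
        have h2 : u.2 + (b * v.2 - u.2) = v.2 := congrArg Prod.snd h
        have : 0 < v.2 := by rw [hv]; positivity
        nlinarith
      · exact hmin k (by omega)

/-- The minimal resolution exists. -/
theorem exists_minimalResolution (hr : 0 < r) (hra : Nat.gcd r a = 1) :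
    Nonempty (MinimalResolution r a) := by
  have hr' : (0 : ℚ) < r := by positivity
  have hdiv : (a : ℚ) = r * (a / r : ℕ) + (a % r : ℕ) := by
    exact_mod_cast (Nat.div_add_mod a r).symm
  have hcl : AddSubgroup.closure {((0 : ℚ), (1 : ℚ)), ((1 : ℚ) / r, ((a % r : ℕ) : ℚ) / r)}
      = latticeN r a := by
    apply le_antisymm <;> rw [latticeN, AddSubgroup.closure_le]
    · rintro x (rfl | rfl)
      · exact AddSubgroup.subset_closure (by simp)
      · have : ((1 : ℚ) / r, ((a % r : ℕ) : ℚ) / r)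
            = ((1 : ℚ) / r, (a : ℚ) / r) - (a / r : ℕ) • ((0 : ℚ), (1 : ℚ)) := by
          ext
          · simp
          · rw [Prod.snd_sub, Prod.smul_snd, nsmul_eq_mul, mul_one]
            rw [hdiv]
            field_simp
            simp
        rw [this]
        exact sub_mem (AddSubgroup.subset_closure (by simp))
          (nsmul_mem (AddSubgroup.subset_closure (by simp)) _)
    · rintro x (rfl | rfl | rfl)
      · have : ((1 : ℚ), (0 : ℚ)) = r • ((1 : ℚ) / r, ((a % r : ℕ) : ℚ) / r)
            - (a % r : ℕ) • ((0 : ℚ), (1 : ℚ)) := by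
          ext
          · simp [hr'.ne']
          · simp [mul_div_cancel₀ _ hr'.ne']
        rw [this]
        exact sub_mem (nsmul_mem (AddSubgroup.subset_closure (by simp)) _)
          (nsmul_mem (AddSubgroup.subset_closure (by simp)) _)
      · exact AddSubgroup.subset_closure (by simp)
      · have : ((1 : ℚ) / r, (a : ℚ) / r) = ((1 : ℚ) / r, ((a % r : ℕ) : ℚ) / r)
            + (a / r : ℕ) • ((0 : ℚ), (1 : ℚ)) := by
          ext
          · simp
          · rw [Prod.snd_add, Prod.smul_snd, nsmul_eq_mul, mul_one]
            rw [hdiv]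
            field_simp
            ring
        rw [this]
        exact add_mem (AddSubgroup.subset_closure (by simp))
          (nsmul_mem (AddSubgroup.subset_closure (by simp)) _)
  obtain ⟨n, ray, h0, -, hl, hnn, hcw, hsm, hmin⟩ :=
    exists_chain hr hra (a % r) r (0, 1) ((1 : ℚ) / r, ((a % r : ℕ) : ℚ) / r) (Nat.mod_lt _ hr)
      (by simp [hr'.ne']) rfl le_rfl (by positivity) (by simp [hr]) hcl
  exact ⟨⟨n + 1, ray, h0, hl, hnn, hcw, hsm, hmin⟩⟩

namespace MinimalResolution

/-- For a set `S` of indices of vectors spanning a cone `σ` of the fan: the coordinate ring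
`ℂ[σ^∨ ∩ M]` of the affine toric chart `U_σ` of `Y`. -/
def regular (F : MinimalResolution r a) (S : Set ℕ) : Subalgebra ℂ Laurent where
  carrier := {f | ∀ m ∈ f.coeff.support, m ∈ latticeM r a ∧ ∀ k ∈ S, 0 ≤ pairing m (F.ray k)}
  mul_mem' := by
    classical
    intro f g hf hg m hm
    obtain ⟨p, hp, q, hq, rfl⟩ :=
      Finset.mem_add.1 (AddMonoidAlgebra.support_coeff_mul_subset f g hm)
    have hpq : ∀ v, pairing (p + q) v = pairing p v + pairing q v := by
      intro v; simp only [pairing, Prod.fst_add, Prod.snd_add]; push_cast; ring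
    refine ⟨fun v hv => ?_, fun k hk => ?_⟩
    · obtain ⟨z, hz⟩ := (hf p hp).1 v hv
      obtain ⟨w, hw⟩ := (hg q hq).1 v hv
      exact ⟨z + w, by rw [hpq, hz, hw]; push_cast; rfl⟩
    · rw [hpq]; exact add_nonneg ((hf p hp).2 k hk) ((hg q hq).2 k hk)
  add_mem' := by
    classical
    intro f g hf hg m hm
    rw [AddMonoidAlgebra.coeff_add] at hm
    rcases Finset.mem_union.1 (Finsupp.support_add hm) with h | h
    · exact hf m h
    · exact hg m h
  algebraMap_mem' := by
    intro c m hm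
    have h0 : m = 0 := by
      by_contra h
      simp [AddMonoidAlgebra.coe_algebraMap, Ne.symm h] at hm
    subst h0
    exact ⟨fun v _ => ⟨0, by simp [pairing]⟩, fun k _ => by simp [pairing]⟩

/-- The reflexive module `M_χ = (ℂ[x,y] ⊗ χ)^G` over `ℂ[x,y]^G`, i.e. the space of semi-invariant
polynomials with character `χ`. -/
def semiInvariants (χ : Character r a) : Submodule ℂ (MvPolynomial (Fin 2) ℂ) where
  carrier := {f | HasWeight f χ}
  add_mem' := by
    intro f g hf hg γ p
    rw [map_add, map_add, hf γ p, hg γ p, mul_add]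
  zero_mem' := by intro γ p; simp
  smul_mem' := by
    intro c f hf γ p
    simp only [MvPolynomial.smul_eval, hf γ p]
    ring

/-- The sections over `U_σ` of the full sheaf `π^*M_χ / torsion` on `Y`: the pullback modulo
torsion is the `𝒪(U_σ)`-submodule generated by `M_χ`. -/
def fullSheaf (F : MinimalResolution r a) (χ : Character r a) (S : Set ℕ) :
    Submodule (F.regular S) Laurent :=
  Submodule.span (F.regular S) (toLaurent '' (semiInvariants χ : Set (MvPolynomial (Fin 2) ℂ)))

/-- The sections over `U_σ` of the dual sheaf `Hom(π^*M_χ / torsion, 𝒪_Y)`. As the full sheaf has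
rank one, homomorphisms to `𝒪_Y` are multiplications by rational functions; as `M_χ` contains
monomials, those functions are Laurent polynomials. -/
def dualSheaf (F : MinimalResolution r a) (χ : Character r a) (S : Set ℕ) :
    Submodule ℂ Laurent where
  carrier := {f | ∀ h ∈ F.fullSheaf χ S, f * h ∈ F.regular S}
  add_mem' := by
    intro f g hf hg h hh
    rw [add_mul]; exact add_mem (hf h hh) (hg h hh)
  zero_mem' := by intro h _; rw [zero_mul]; exact zero_mem _
  smul_mem' := by
    intro c f hf h hh
    rw [smul_mul_assoc]; exact (F.regular S).smul_mem (hf h hh) c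

/-- The indices of the vectors spanning the intersection of the `i`-th and the `j`-th maximal
cone, so that `U_i ∩ U_j` is the corresponding chart; for `i = j` it is the chart `U_i` itself. -/
def overlap (i j : ℕ) : Set ℕ := {i, i + 1} ∩ {j, j + 1}

/-- Čech 1-cocycles of the dual of the full sheaf, for the covering of `Y` by the affine charts of
the maximal cones. -/
def cocycles (F : MinimalResolution r a) (χ : Character r a) :
    Submodule ℂ (Fin F.n → Fin F.n → Laurent) where
  carrier := {f | (∀ i j : Fin F.n, f i j ∈ F.dualSheaf χ (overlap i j)) ∧
    ∀ i j k, f i j + f j k = f i k}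
  add_mem' := by
    intro f g hf hg
    refine ⟨fun i j => add_mem (hf.1 i j) (hg.1 i j), fun i j k => ?_⟩
    simp only [Pi.add_apply, ← hf.2 i j k, ← hg.2 i j k]; abel
  zero_mem' := ⟨fun _ _ => zero_mem _, fun _ _ _ => by simp⟩
  smul_mem' := by
    intro c f hf
    refine ⟨fun i j => Submodule.smul_mem _ c (hf.1 i j), fun i j k => ?_⟩
    simp only [Pi.smul_apply, ← hf.2 i j k, smul_add]

/-- Čech 1-coboundaries for the same covering. -/
def coboundaries (F : MinimalResolution r a) (χ : Character r a) :
    Submodule ℂ (Fin F.n → Fin F.n → Laurent) where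
  carrier := {f | ∃ g : Fin F.n → Laurent,
    (∀ i : Fin F.n, g i ∈ F.dualSheaf χ (overlap i i)) ∧ ∀ i j, f i j = g j - g i}
  add_mem' := by
    rintro f f' ⟨g, hg, hf⟩ ⟨g', hg', hf'⟩
    refine ⟨g + g', fun i => add_mem (hg i) (hg' i), fun i j => ?_⟩
    simp only [Pi.add_apply, hf, hf']; abel
  zero_mem' := ⟨0, fun _ => zero_mem _, fun _ _ => by simp⟩
  smul_mem' := by
    rintro c f ⟨g, hg, hf⟩
    refine ⟨c • g, fun i => Submodule.smul_mem _ c (hg i), fun i j => ?_⟩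
    simp only [Pi.smul_apply, hf, smul_sub]

/-- The cohomology group `H¹(Y, (π^*M_χ / torsion)^∨)`. -/
abbrev H1 (F : MinimalResolution r a) (χ : Character r a) : Type :=
  F.cocycles χ ⧸ (F.coboundaries χ).comap (F.cocycles χ).subtype

end MinimalResolution

/-- The representation of `G` given by the character `χ` is special in the sense of Wunram:
`H¹(Y, (π^*M_χ / torsion)^∨) = 0`, where `π : Y → ℂ²/G` is the minimal resolution (which exists,
see `exists_minimalResolution`, and is unique). -/
def IsSpecial (χ : Character r a) : Prop :=
  ∀ F : MinimalResolution r a, Subsingleton (F.H1 χ)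

end

end CyclicQuotient

/-! Specialness is reduced to a property of the semi-invariants: `M_χ` is generated by one power of
`x` and one power of `y` (`GeneratedByPurePowers`).

Socles give this property (`exists_pure_powers_of_corner`). If `X` is a corner of the staircase `Γ`,
the representative in `Γ` of the weight of `X·x` cannot be divisible by `x`, since cancelling `x`
would give `X`. So it is some `y^b`, and likewise the weight of `X·y` is represented by some `x^c`.
Hence `x^(c+1)` and `y^(b+1)` have the weight of `X·xy`. Unless that weight is trivial, injectivity
of the weight on `Γ` excludes any further generator.

The property kills `H¹`, by a computation in each Laurent degree `p`. Along a ray `v` of the fan,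
the full sheaf has order `min (m v₁) (n v₂)`, so `p` is a pole of the dual where `⟨-p, v⟩` exceeds
this minimum. By `isPole_between` the rays with poles form an interval. A cocycle therefore has no
term of degree `p` between two charts that both meet the poles. Taking such a chart as base point,
whenever one exists, writes the cocycle as a coboundary (`mem_coboundaries`). -/

namespace CyclicQuotient

open MvPolynomial (monomial)

/-! ### Combinatorics of a corner of a staircase. -/

section Staircase

variable {C : Type*} [CommGroup C] {α β : C} {Γ : ℕ → ℕ → Prop}

/-- If `(s, t)` is a corner of a staircase on which the exponents are separated by their weights,
then the monomials of the weight of `(s + 1, t + 1)` are generated by a pure power of each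
variable. -/
theorem exists_pure_powers_of_corner
    (down : ∀ i j k l, Γ i j → k ≤ i → l ≤ j → Γ k l)
    (inj : ∀ i j k l, Γ i j → Γ k l → α ^ i * β ^ j = α ^ k * β ^ l → i = k ∧ j = l)
    (surj : ∀ i j, ∃ k l, Γ k l ∧ α ^ k * β ^ l = α ^ i * β ^ j)
    {s t : ℕ} (hst : Γ s t) (hs : ¬ Γ (s + 1) t) (ht : ¬ Γ s (t + 1)) :
    ∃ m n : ℕ, α ^ m = α ^ (s + 1) * β ^ (t + 1) ∧ β ^ n = α ^ (s + 1) * β ^ (t + 1) ∧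
      ∀ i j, α ^ i * β ^ j = α ^ (s + 1) * β ^ (t + 1) → m ≤ i ∨ n ≤ j := by
  by_cases h1 : α ^ (s + 1) * β ^ (t + 1) = 1
  · exact ⟨0, 0, by simp [h1], by simp [h1], by simp⟩
  have inj' : ∀ d e, Γ d 0 → Γ 0 e → α ^ d = β ^ e → d = 0 ∧ e = 0 := by
    intro d e hd he h
    have := inj d 0 0 e hd he (by simpa using h)
    omega
  obtain ⟨b, hb, hbw⟩ : ∃ b, Γ 0 b ∧ β ^ b = α ^ (s + 1) * β ^ t := by
    obtain ⟨k, b, hkb, hw⟩ := surj (s + 1) t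
    rcases k with _ | k
    · exact ⟨b, hkb, by simpa using hw⟩
    · have hw' : α ^ k * β ^ b = α ^ s * β ^ t := by
        rw [pow_succ, pow_succ, mul_right_comm, mul_right_comm (α ^ s)] at hw
        exact mul_right_cancel hw
      obtain ⟨rfl, rfl⟩ := inj k b s t (down _ _ _ _ hkb (by omega) le_rfl) hst hw'
      exact absurd hkb hs
  obtain ⟨c, hc, hcw⟩ : ∃ c, Γ c 0 ∧ α ^ c = α ^ s * β ^ (t + 1) := by
    obtain ⟨c, l, hcl, hw⟩ := surj s (t + 1)
    rcases l with _ | l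
    · exact ⟨c, hcl, by simpa using hw⟩
    · have hw' : α ^ c * β ^ l = α ^ s * β ^ t := by
        rw [pow_succ, pow_succ, ← mul_assoc, ← mul_assoc] at hw
        exact mul_right_cancel hw
      obtain ⟨rfl, rfl⟩ := inj c l s t (down _ _ _ _ hcl le_rfl (by omega)) hst hw'
      exact absurd hcl ht
  -- Otherwise `x^(s+1)` and `y^(b-t)` both lie in `Γ` and have the same weight.
  have hcorner : b ≤ t ∨ c ≤ s := by
    by_contra! hlt
    obtain ⟨e, rfl⟩ := Nat.exists_eq_add_of_lt hlt.1
    have : α ^ (s + 1) = β ^ (e + 1) := by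
      apply mul_right_cancel (b := β ^ t)
      rw [← hbw, ← pow_add]; congr 1; omega
    have := inj' _ _ (down _ _ _ _ hc (by omega) le_rfl) (down _ _ _ _ hb le_rfl (by omega)) this
    omega
  refine ⟨c + 1, b + 1, ?_, ?_, fun i j hij => ?_⟩
  · rw [pow_succ, hcw, pow_succ α s, mul_right_comm]
  · rw [pow_succ, hbw, pow_succ β t, mul_assoc]
  by_contra! hlt
  obtain ⟨hic, hjb⟩ := hlt
  -- A pure power of weight `χ` below `y^(b+1)` or `x^(c+1)` makes a smaller positive power, still
  -- in `Γ`, have trivial weight. Only the exponent zero escapes, and this is excluded by `h1`.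
  rcases i with _ | i
  · obtain ⟨e, he⟩ := Nat.exists_eq_add_of_le (Nat.lt_succ_iff.1 hjb)
    have hj : j = 0 := by
      by_contra hj
      have : β ^ (e + 1) = 1 := by
        apply mul_left_cancel (a := β ^ j)
        rw [← pow_add, mul_one, ← one_mul (β ^ j), ← pow_zero α, hij, pow_succ β t, ← mul_assoc,
          ← hbw, ← pow_succ]
        congr 1; omega
      have := inj' 0 _ (down _ _ _ _ hb le_rfl (by omega))
        (down _ _ _ _ hb le_rfl (by omega : e + 1 ≤ b)) (by simpa using this.symm)
      omega
    exact h1 (by rw [← hij, hj]; simp)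
  rcases j with _ | j
  · obtain ⟨e, he⟩ := Nat.exists_eq_add_of_lt hic
    have : α ^ (e + 1) = 1 := by
      apply mul_left_cancel (a := α ^ (i + 1))
      rw [← pow_add, mul_one, ← mul_one (α ^ (i + 1)), ← pow_zero β, hij, pow_succ α s,
        mul_right_comm, ← hcw, ← pow_succ]
      congr 1; omega
    have := inj' _ 0 (down _ _ _ _ hc (by omega : e + 1 ≤ c) le_rfl)
      (down _ _ _ _ hc (by omega) le_rfl) (by simpa using this)
    omega
  have hij' : α ^ i * β ^ j = α ^ s * β ^ t := by
    apply mul_right_cancel (b := α * β)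
    rw [mul_mul_mul_comm, mul_mul_mul_comm (α ^ s), ← pow_succ, ← pow_succ, ← pow_succ, ← pow_succ,
      hij]
  -- After division by `xy` the weight is that of the corner. Weakly below the corner it must be the
  -- corner itself, and there, as strictly beyond it in both directions, `hcorner` is violated. In
  -- the mixed cases a power of `x` and a power of `y`, both in `Γ`, share a weight.
  rcases le_or_gt i s with hi | hi <;> rcases le_or_gt j t with hj | hj
  · obtain ⟨rfl, rfl⟩ := inj i j s t (down _ _ _ _ hst hi hj) hst hij'
    omega
  · obtain ⟨d, rfl⟩ := Nat.exists_eq_add_of_le hi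
    obtain ⟨e, rfl⟩ := Nat.exists_eq_add_of_lt hj
    have : α ^ d = β ^ (e + 1) := by
      apply mul_left_cancel (a := α ^ i * β ^ t)
      rw [mul_assoc _ _ (β ^ (e + 1)), ← pow_add, mul_right_comm, ← pow_add, ← hij', add_assoc]
    have := inj' _ _ (down _ _ _ _ hst (by omega) (by omega))
      (down _ _ _ _ hb le_rfl (by omega)) this
    omega
  · obtain ⟨d, rfl⟩ := Nat.exists_eq_add_of_lt hi
    obtain ⟨e, rfl⟩ := Nat.exists_eq_add_of_le hj
    have : α ^ (d + 1) = β ^ e := by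
      apply mul_left_cancel (a := α ^ s * β ^ j)
      rw [mul_assoc _ _ (β ^ e), ← pow_add, mul_right_comm, ← pow_add, ← hij', add_assoc]
    have := inj' _ _ (down _ _ _ _ hc (by omega) (by omega))
      (down _ _ _ _ hst (by omega) (by omega)) this
    omega
  · omega

end Staircase

/-! ### Weights of monomials and of semi-invariant polynomials. -/

section Weights

variable {r a : ℕ}

theorem wt_add (u v : Mon) : wt r a (u + v) = wt r a u * wt r a v := by
  ext g
  simp [wt, pow_add]
  ring

theorem character_ext {χ ψ : Character r a}
    (h : χ ⟨gen r a, Subgroup.mem_zpowers _⟩ = ψ ⟨gen r a, Subgroup.mem_zpowers _⟩) : χ = ψ := by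
  ext ⟨g, hg⟩
  obtain ⟨k, rfl⟩ := Subgroup.mem_zpowers_iff.1 hg
  have : (⟨gen r a ^ k, hg⟩ : grp r a) = ⟨gen r a, Subgroup.mem_zpowers _⟩ ^ k := rfl
  rw [this, map_zpow, map_zpow, h]

theorem wt_apply_gen (u : Mon) :
    ((wt r a u ⟨gen r a, Subgroup.mem_zpowers _⟩ : ℂˣ) : ℂ) = eps r ^ (u 0 + a * u 1) := by
  simp [wt, coordChar, gen, pow_add, pow_mul]

theorem wt_eq_chi (u : Mon) : wt r a u = chi r a (u 0 + a * u 1) :=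
  character_ext (Units.ext (by rw [wt_apply_gen, chi_gen]))

theorem chi_mul_wt (X : Mon) : chi r a (1 + a) * wt r a X = wt r a (X + xy) := by
  have h : wt r a xy = chi r a (1 + a) := by rw [wt_eq_chi]; simp [xy]
  rw [← h, add_comm, wt_add]

/-- Pairing with the lattice vector `(1/r, a/r)` shows that the exponents of `ε` differ by a
multiple of `r`. -/
theorem wt_eq_of_sub_mem_latticeM (hr : 0 < r) {u v : Mon}
    (h : ((u 0 : ℤ) - v 0, (u 1 : ℤ) - v 1) ∈ latticeM r a) : wt r a u = wt r a v := by
  obtain ⟨z, hz⟩ := h ((1 : ℚ) / r, (a : ℚ) / r) (AddSubgroup.subset_closure (by simp))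
  have hr' : (r : ℚ) ≠ 0 := by positivity
  have hz' : ((u 0 + a * u 1 : ℕ) : ℤ) = (v 0 + a * v 1 : ℕ) + r * z := by
    simp only [pairing] at hz
    field_simp at hz
    push_cast at hz ⊢
    have : ((u 0 : ℚ) - v 0 + a * (u 1 - v 1)) = r * z := by linarith
    have : ((u 0 : ℤ) - v 0 + a * (u 1 - v 1)) = r * z := by exact_mod_cast this
    linarith
  refine character_ext (Units.ext ?_)
  have he : eps r ^ (r : ℤ) = 1 := by
    rw [zpow_natCast]
    exact (Complex.isPrimitiveRoot_exp r hr.ne').pow_eq_one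
  have he0 : eps r ≠ 0 := Complex.exp_ne_zero _
  rw [wt_apply_gen, wt_apply_gen, ← zpow_natCast, hz', zpow_add₀ he0, zpow_mul, he, one_zpow,
    mul_one, zpow_natCast]

theorem eq_single_add_single (u : Mon) :
    u = Finsupp.single 0 (u 0) + Finsupp.single 1 (u 1) := by
  ext i; fin_cases i <;> simp

theorem wt_single_add_single (i j : ℕ) :
    wt r a (Finsupp.single 0 i + Finsupp.single 1 j) = coordChar r a 0 ^ i * coordChar r a 1 ^ j := by
  simp [wt]

/-- The module of semi-invariants with character `χ` is generated by a power of `x` and a power of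
`y`. -/
def GeneratedByPurePowers (χ : Character r a) : Prop :=
  ∃ m n : ℕ, wt r a (Finsupp.single 0 m) = χ ∧ wt r a (Finsupp.single 1 n) = χ ∧
    ∀ u, wt r a u = χ → m ≤ u 0 ∨ n ≤ u 1

theorem IsGGraph.mem_of_le {Γ : Set Mon} (hΓ : IsGGraph r a Γ) {u v : Mon} (hu : u ∈ Γ)
    (h : v ≤ u) : v ∈ Γ := by
  obtain ⟨⟨I, -, rfl⟩, -⟩ := hΓ
  intro hv
  refine hu (I.mem_of_dvd ?_ hv)
  exact MvPolynomial.monomial_dvd_monomial.2 ⟨Or.inr h, dvd_rfl⟩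

theorem IsSocle.add_notMem {Γ : Set Mon} {X : Mon} (hX : IsSocle Γ X) {e : Mon} (he : e ≠ 0) :
    X + e ∉ Γ := by
  intro h
  refine he ?_
  have := hX.2 _ h (MvPolynomial.monomial_dvd_monomial.2 ⟨Or.inr le_self_add, dvd_rfl⟩)
  simpa using this

theorem generatedByPurePowers_of_socle {Γ : Set Mon} {X : Mon} (hΓ : IsGGraph r a Γ)
    (hX : IsSocle Γ X) : GeneratedByPurePowers (wt r a (X + xy)) := by
  have hXs := eq_single_add_single X
  obtain ⟨m, n, hm, hn, h⟩ := exists_pure_powers_of_corner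
    (α := coordChar r a 0) (β := coordChar r a 1)
    (Γ := fun i j => (Finsupp.single 0 i + Finsupp.single 1 j : Mon) ∈ Γ) (s := X 0) (t := X 1)
    (fun i j k l hij hk hl => hΓ.mem_of_le hij
      (add_le_add (Finsupp.single_le_single.2 hk) (Finsupp.single_le_single.2 hl)))
    (fun i j k l hij hkl hw => by
      rw [← wt_single_add_single, ← wt_single_add_single] at hw
      have := hΓ.2.injOn hij hkl hw
      exact ⟨by simpa using DFunLike.congr_fun this 0, by simpa using DFunLike.congr_fun this 1⟩)
    (fun i j => by
      obtain ⟨u, hu, hw⟩ := hΓ.2.surjOn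
        (Set.mem_univ (coordChar r a 0 ^ i * coordChar r a 1 ^ j))
      exact ⟨u 0, u 1, by rwa [← eq_single_add_single], hw⟩)
    (by rw [← hXs]; exact hX.1)
    (by
      rw [Finsupp.single_add, add_right_comm, ← hXs]
      exact hX.add_notMem (by simp))
    (by
      rw [Finsupp.single_add, ← add_assoc, ← hXs]
      exact hX.add_notMem (by simp))
  have hw : wt r a (X + xy) = coordChar r a 0 ^ (X 0 + 1) * coordChar r a 1 ^ (X 1 + 1) := by
    simp [wt, xy]
  refine ⟨m, n, ?_, ?_, fun u hu => h _ _ (hu.trans hw)⟩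
  · rw [hw, ← hm]; ext g; simp [wt]
  · rw [hw, ← hn]; ext g; simp [wt]

/-- Acting by `g` scales each term by its own weight, while semi-invariance scales all of them by `χ
g`. Over the infinite field `ℂ` equal values give equal coefficients. -/
theorem HasWeight.wt_eq {f : MvPolynomial (Fin 2) ℂ} {χ : Character r a} (hf : HasWeight f χ)
    {u : Mon} (hu : u ∈ f.support) : wt r a u = χ := by
  ext g
  have key : ∑ v ∈ f.support, monomial v ((wt r a v g : ℂ) * f.coeff v) =
      MvPolynomial.C (χ g : ℂ) * f := by
    refine MvPolynomial.funext fun p => ?_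
    rw [map_mul, MvPolynomial.eval_C, ← hf g p]
    conv_rhs => rw [f.as_sum]
    rw [map_sum, map_sum]
    refine Finset.sum_congr rfl fun v _ => ?_
    have h1 := (hasWeight_mono_iff v _).2 rfl g p
    have h2 : ∀ c : ℂ, monomial v c = MvPolynomial.C c * mono v := fun c => by
      rw [mono, MvPolynomial.C_mul_monomial, mul_one]
    rw [h2, h2]
    simp only [map_mul, h1, MvPolynomial.eval_C]
    ring
  have hc := congrArg (MvPolynomial.coeff u) key
  rw [MvPolynomial.coeff_C_mul, MvPolynomial.coeff_sum,
    Finset.sum_eq_single u (fun v _ hv => by rw [MvPolynomial.coeff_monomial, if_neg hv])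
      (fun h => absurd hu h), MvPolynomial.coeff_monomial, if_pos rfl] at hc
  exact mul_right_cancel₀ (MvPolynomial.mem_support_iff.1 hu) hc

end Weights

/-! ### Plane geometry of vectors in the first quadrant. -/

section Plane

/-- The determinant of `w` and `v`, positive if `w` is clockwise from `v`. -/
def cross (v w : ℚ × ℚ) : ℚ := w.1 * v.2 - v.1 * w.2

theorem cross_pos_trans {u v w : ℚ × ℚ} (hu : 0 ≤ u.1 ∧ 0 ≤ u.2) (hv : 0 ≤ v.1 ∧ 0 ≤ v.2)
    (hw : 0 ≤ w.1 ∧ 0 ≤ w.2) (huv : 0 < cross u v) (hvw : 0 < cross v w) : 0 < cross u w := by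
  unfold cross at *
  have h1 : 0 < v.1 := by
    by_contra! h
    nlinarith [mul_nonneg hu.1 hv.2, mul_nonneg hv.1 hu.2]
  have h2 : 0 < w.1 := by
    by_contra! h
    nlinarith [mul_nonneg hv.1 hw.2, mul_nonneg hw.1 hv.2]
  have h3 : v.1 * (w.1 * u.2 - u.1 * w.2)
      = (w.1 * v.2 - v.1 * w.2) * u.1 + (v.1 * u.2 - u.1 * v.2) * w.1 := by ring
  have h4 : 0 < v.1 * (w.1 * u.2 - u.1 * w.2) := by
    rw [h3]; exact add_pos_of_nonneg_of_pos (mul_nonneg hvw.le hu.1) (mul_pos huv h2)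
  exact pos_of_mul_pos_right h4 h1.le

/-- A linear form that is positive on two vectors is positive on the vectors between them. -/
theorem pairing_pos_of_between {u v w : ℚ × ℚ} (huv : 0 < cross u v) (hvw : 0 < cross v w)
    (huw : 0 < cross u w) {x y : ℚ} (hu : 0 < x * u.1 + y * u.2) (hw : 0 < x * w.1 + y * w.2) :
    0 < x * v.1 + y * v.2 := by
  refine pos_of_mul_pos_right (a := cross u w) ?_ huw.le
  have : cross u w * (x * v.1 + y * v.2)
      = cross v w * (x * u.1 + y * u.2) + cross u v * (x * w.1 + y * w.2) := by
    unfold cross; ring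
  rw [this]
  exact add_pos (mul_pos hvw hu) (mul_pos huv hw)

/-- A vector `(p, q)` violating `⟨(p, q), -⟩ ≤ min (m x) (n y)` at two vectors of the quadrant
violates it in between, unless it has nonnegative entries and is neither `≥ (m, 0)` nor
`≥ (0, n)`. -/
theorem exceeds_between {u v w : ℚ × ℚ} (hu : 0 ≤ u.1 ∧ 0 ≤ u.2) (hv : 0 ≤ v.1 ∧ 0 ≤ v.2)
    (hw : 0 ≤ w.1 ∧ 0 ≤ w.2) (huv : 0 < cross u v) (hvw : 0 < cross v w) {p q m n : ℚ}
    (hm : 0 ≤ m) (hn : 0 ≤ n) (hpq : 0 ≤ p → 0 ≤ q → m ≤ p ∨ n ≤ q)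
    (h1 : m * u.1 < p * u.1 + q * u.2 ∨ n * u.2 < p * u.1 + q * u.2)
    (h2 : m * w.1 < p * w.1 + q * w.2 ∨ n * w.2 < p * w.1 + q * w.2) :
    m * v.1 < p * v.1 + q * v.2 ∨ n * v.2 < p * v.1 + q * v.2 := by
  have huw := cross_pos_trans hu hv hw huv hvw
  -- The violation region is a union of two open half-planes. If both outer vectors lie in the same
  -- one, so does the vector between them.
  have hcx : (m * u.1 < p * u.1 + q * u.2 ∧ m * w.1 < p * w.1 + q * w.2) →
      m * v.1 < p * v.1 + q * v.2 := fun h => by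
    have := pairing_pos_of_between huv hvw huw (x := p - m) (y := q)
      (by linarith [h.1]) (by linarith [h.2])
    linarith
  have hcy : (n * u.2 < p * u.1 + q * u.2 ∧ n * w.2 < p * w.1 + q * w.2) →
      n * v.2 < p * v.1 + q * v.2 := fun h => by
    have := pairing_pos_of_between huv hvw huw (x := p) (y := q - n)
      (by linarith [h.1]) (by linarith [h.2])
    linarith
  rcases h1 with h1 | h1 <;> rcases h2 with h2 | h2
  · exact Or.inl (hcx ⟨h1, h2⟩)
  -- The essential case: the outer vectors lie in different half-planes. If `p < 0`, the violation
  -- at `w` persists when turning towards the `y`-axis, hence at `v`; if `q < 0`, the one at `u`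
  -- persists towards the `x`-axis. If both are nonnegative, `hpq` makes one of the two forms
  -- nonnegative on the quadrant, and its failure at `v` forces it to vanish identically.
  · by_contra! hk
    obtain ⟨hk1, hk2⟩ := hk
    unfold cross at huv hvw
    have hv1 : 0 < v.1 := by
      by_contra! h
      nlinarith [mul_nonneg hu.1 hv.2, mul_nonneg hv.1 hu.2]
    have hv2 : 0 < v.2 := by
      by_contra! h
      nlinarith [mul_nonneg hv.1 hw.2, mul_nonneg hw.1 hv.2]
    rcases lt_or_ge p 0 with hp | hp
    · have hq : 0 < (q - n) := by
        by_contra! h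
        nlinarith [mul_nonneg hw.1 (neg_nonneg.2 hp.le), mul_nonneg hw.2 (neg_nonneg.2 h)]
      have e1 : -p * w.1 * v.1 ≤ (q - n) * w.2 * v.1 :=
        mul_le_mul_of_nonneg_right (by linarith) hv1.le
      have e2 : (q - n) * v.2 * w.1 ≤ -p * v.1 * w.1 :=
        mul_le_mul_of_nonneg_right (by linarith) hw.1
      nlinarith [mul_pos hq hvw]
    rcases lt_or_ge q 0 with hq | hq
    · have hp : 0 < (p - m) := by
        by_contra! h
        nlinarith [mul_nonneg hu.2 (neg_nonneg.2 hq.le), mul_nonneg hu.1 (neg_nonneg.2 h)]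
      have e1 : -q * u.2 * v.2 ≤ (p - m) * u.1 * v.2 :=
        mul_le_mul_of_nonneg_right (by linarith) hv2.le
      have e2 : (p - m) * v.1 * u.2 ≤ -q * v.2 * u.2 :=
        mul_le_mul_of_nonneg_right (by linarith) hu.2
      nlinarith [mul_pos hp huv]
    rcases hpq hp hq with h | h
    · have e1 : p = m := by nlinarith [mul_nonneg hq hv2.le]
      have e2 : q = 0 := by nlinarith
      rw [e1, e2] at h1
      linarith
    · have e1 : q = n := by nlinarith [mul_nonneg hp hv1.le]
      have e2 : p = 0 := by nlinarith
      rw [e1, e2] at h2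
      linarith
  · by_cases h3 : m * u.1 < p * u.1 + q * u.2
    · exact Or.inl (hcx ⟨h3, h2⟩)
    by_cases h4 : n * w.2 < p * w.1 + q * w.2
    · exact Or.inr (hcy ⟨h1, h4⟩)
    -- Now `n y < m x` at `u` and `m x < n y` at `w`, although turning clockwise can only favour `m
    -- x`.
    exfalso
    push Not at h3 h4
    have e1 : n * u.2 < m * u.1 := by linarith
    have e2 : m * w.1 < n * w.2 := by linarith
    have e3 := mul_le_mul_of_nonneg_right e1.le hw.2
    have e4 := mul_le_mul_of_nonneg_right e2.le hu.2
    have e5 : m * cross u w ≤ 0 := by unfold cross; linarith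
    have e6 : m = 0 := le_antisymm (nonpos_of_mul_nonpos_left e5 huw) hm
    rw [e6, zero_mul] at e1
    linarith [mul_nonneg hn hu.2]
  · exact Or.inr (hcy ⟨h1, h2⟩)

end Plane

/-! ### Pole orders along the rays and monomial sections of the dual sheaf. -/

namespace MinimalResolution

variable {r a : ℕ} (F : MinimalResolution r a)

theorem cross_ray_pos {i j : ℕ} (hij : i < j) (hj : j ≤ F.n) : 0 < cross (F.ray i) (F.ray j) := by
  induction j, hij using Nat.le_induction with
  | base => exact F.clockwise i (by omega)
  | succ j hij ih =>
    exact cross_pos_trans (F.nonneg i (by omega)) (F.nonneg j (by omega)) (F.nonneg _ hj)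
      (ih (by omega)) (F.clockwise j (by omega))

/-- The exponent of a monomial, as the exponent of a Laurent monomial. -/
def toInt (u : Mon) : ℤ × ℤ := (u 0, u 1)

/-- The Laurent monomial with exponent `p` does not extend to a section of the dual of the full
sheaf along the divisor of the `k`-th vector. -/
def IsPole (χ : Character r a) (p : ℤ × ℤ) (k : ℕ) : Prop :=
  ∃ u, wt r a u = χ ∧ pairing (p + toInt u) (F.ray k) < 0

theorem pairing_add_toInt (p : ℤ × ℤ) (u : Mon) (v : ℚ × ℚ) :
    pairing (p + toInt u) v = p.1 * v.1 + p.2 * v.2 + u 0 * v.1 + u 1 * v.2 := by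
  simp only [pairing, toInt, Prod.fst_add, Prod.snd_add]
  push_cast; ring

/-- This is where generation by pure powers enters: if `-p` is the exponent of a monomial of weight
`χ`, it is at least `m` in `x` or at least `n` in `y`, which is what `exceeds_between` needs. -/
theorem isPole_between (hr : 0 < r) {χ : Character r a} (hχ : GeneratedByPurePowers χ)
    {p : ℤ × ℤ} (hp : ∀ u, wt r a u = χ → p + toInt u ∈ latticeM r a) {i k j : ℕ} (hik : i ≤ k)
    (hkj : k ≤ j) (hj : j ≤ F.n) (h1 : F.IsPole χ p i) (h2 : F.IsPole χ p j) :
    F.IsPole χ p k := by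
  rcases hik.eq_or_lt with rfl | hik
  · exact h1
  rcases hkj.eq_or_lt with rfl | hkj
  · exact h2
  obtain ⟨m, n, hm, hn, h⟩ := hχ
  -- The rays have nonnegative entries, so the generators `x^m` and `y^n` already detect all poles.
  have key : ∀ l ≤ F.n, F.IsPole χ p l ↔
      (m : ℚ) * (F.ray l).1 < (-p.1 : ℚ) * (F.ray l).1 + (-p.2 : ℚ) * (F.ray l).2 ∨
      (n : ℚ) * (F.ray l).2 < (-p.1 : ℚ) * (F.ray l).1 + (-p.2 : ℚ) * (F.ray l).2 := by
    intro l hl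
    have hnn := F.nonneg l hl
    constructor
    · rintro ⟨u, hu, hlt⟩
      rw [pairing_add_toInt] at hlt
      have h0 : (0 : ℚ) ≤ u 0 * (F.ray l).1 := mul_nonneg (by positivity) hnn.1
      have h1 : (0 : ℚ) ≤ u 1 * (F.ray l).2 := mul_nonneg (by positivity) hnn.2
      rcases h u hu with hm' | hn'
      · left
        have : (m : ℚ) * (F.ray l).1 ≤ u 0 * (F.ray l).1 :=
          mul_le_mul_of_nonneg_right (by exact_mod_cast hm') hnn.1
        linarith
      · right
        have : (n : ℚ) * (F.ray l).2 ≤ u 1 * (F.ray l).2 :=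
          mul_le_mul_of_nonneg_right (by exact_mod_cast hn') hnn.2
        linarith
    · rintro (hlt | hlt)
      · refine ⟨_, hm, ?_⟩
        rw [pairing_add_toInt]
        simp only [Finsupp.single_eq_same, ne_eq, one_ne_zero, not_false_eq_true,
          Finsupp.single_eq_of_ne, Nat.cast_zero, zero_mul]
        linarith
      · refine ⟨_, hn, ?_⟩
        rw [pairing_add_toInt]
        simp only [Finsupp.single_eq_same, ne_eq, zero_ne_one, not_false_eq_true,
          Finsupp.single_eq_of_ne, Nat.cast_zero, zero_mul]
        linarith
  rw [key _ (by omega)] at h1 h2 ⊢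
  refine exceeds_between (F.nonneg i (by omega)) (F.nonneg k (by omega)) (F.nonneg j hj)
    (F.cross_ray_pos hik (by omega)) (F.cross_ray_pos hkj hj) (by positivity) (by positivity)
    ?_ h1 h2
  intro hp1 hp2
  obtain ⟨s, hs⟩ : ∃ s : ℕ, (s : ℤ) = -p.1 := ⟨_, Int.toNat_of_nonneg (by exact_mod_cast hp1)⟩
  obtain ⟨t, ht⟩ : ∃ t : ℕ, (t : ℤ) = -p.2 := ⟨_, Int.toNat_of_nonneg (by exact_mod_cast hp2)⟩
  have hw : wt r a (Finsupp.single 0 m) = wt r a (Finsupp.single 0 s + Finsupp.single 1 t) := by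
    apply wt_eq_of_sub_mem_latticeM hr
    convert hp _ hm using 1
    ext <;> simp [toInt, hs, ht, add_comm]
  have := h _ (hw.symm.trans hm)
  simp only [Finsupp.add_apply, Finsupp.single_eq_same, ne_eq, one_ne_zero, zero_ne_one,
    not_false_eq_true, Finsupp.single_eq_of_ne, add_zero, zero_add] at this
  have e1 : (-p.1 : ℚ) = s := by exact_mod_cast hs.symm
  have e2 : (-p.2 : ℚ) = t := by exact_mod_cast ht.symm
  rw [e1, e2]
  exact_mod_cast this

theorem toLaurent_monomial (u : Mon) (c : ℂ) :
    toLaurent (monomial u c) = AddMonoidAlgebra.single (toInt u) c := by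
  rw [toLaurent, MvPolynomial.aeval_monomial, Finsupp.prod_fintype _ _ (by simp)]
  simp [Fin.prod_univ_two, AddMonoidAlgebra.single_pow, AddMonoidAlgebra.single_mul_single, toInt]

/-- All modules involved are graded by Laurent exponents, so it suffices to test terms of `f`
against monomials in `M_χ`. -/
theorem mem_dualSheaf_iff {χ : Character r a} {S : Set ℕ} {f : Laurent} :
    f ∈ F.dualSheaf χ S ↔ ∀ p ∈ f.coeff.support, ∀ u, wt r a u = χ →
      p + toInt u ∈ latticeM r a ∧ ∀ k ∈ S, 0 ≤ pairing (p + toInt u) (F.ray k) := by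
  classical
  constructor
  · intro hf p hp u hu
    have hmem := hf (toLaurent (mono u)) (Submodule.subset_span
      ⟨_, (hasWeight_mono_iff u χ).2 hu.symm, rfl⟩)
    refine hmem _ ?_
    rw [mono, toLaurent_monomial, Finsupp.mem_support_iff, AddMonoidAlgebra.coeff_mul_single_apply]
    simpa using hp
  · intro hf h hh
    induction hh using Submodule.span_induction with
    | mem x hx =>
      obtain ⟨φ, hφ, rfl⟩ := hx
      rw [φ.as_sum, map_sum, Finset.mul_sum]
      refine sum_mem fun u hu m hm => ?_
      rw [toLaurent_monomial] at hm
      obtain ⟨p, hp, q, hq, rfl⟩ :=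
        Finset.mem_add.1 (AddMonoidAlgebra.support_coeff_mul_subset _ _ hm)
      obtain rfl : q = toInt u := by
        have := Finsupp.support_single_subset hq
        simpa using this
      exact hf p hp u (HasWeight.wt_eq hφ hu)
    | zero => rw [mul_zero]; exact zero_mem _
    | add x y _ _ hx hy => rw [mul_add]; exact add_mem hx hy
    | smul c x _ hx =>
      rw [Subalgebra.smul_def, smul_eq_mul, mul_left_comm]
      exact mul_mem c.2 hx

/-! ### Vanishing of the Čech cohomology, one Laurent degree at a time. -/

section Cech

variable {F} {χ : Character r a} {f : Fin F.n → Fin F.n → Laurent}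

theorem cocycle_add_apply (hf : f ∈ F.cocycles χ) (i j k : Fin F.n) (p : ℤ × ℤ) :
    (f i j).coeff p + (f j k).coeff p = (f i k).coeff p := by
  rw [← hf.2 i j k]; rfl

/-- A cocycle has no terms between two charts if these terms have poles along all divisors in
between. -/
theorem cocycle_apply_eq_zero (hf : f ∈ F.cocycles χ) {p : ℤ × ℤ} (i : Fin F.n) (k : ℕ)
    (hk : k < F.n) (hik : (i : ℕ) ≤ k) (hpole : ∀ l, (i : ℕ) < l → l ≤ k → F.IsPole χ p l) :
    (f i ⟨k, hk⟩).coeff p = 0 := by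
  induction k, hik using Nat.le_induction with
  | base => simpa using cocycle_add_apply hf i i i p
  | succ k hik ih =>
    -- Splitting at chart `k` leaves the step to chart `k + 1`. The overlap contains the ray `k +
    -- 1`, where a term of degree `p` would have a pole.
    rw [← cocycle_add_apply hf i ⟨k, by omega⟩,
      ih (by omega) fun l h1 h2 => hpole l h1 (by omega), zero_add]
    by_contra hne
    obtain ⟨u, hu, hlt⟩ := hpole (k + 1) (by omega) le_rfl
    have := (F.mem_dualSheaf_iff.1 (hf.1 ⟨k, by omega⟩ ⟨k + 1, hk⟩) p
      (Finsupp.mem_support_iff.2 hne) u hu).2 (k + 1) (by simp [overlap])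
    linarith

theorem cocycle_apply_eq_zero_of_isPole (hr : 0 < r) (hχ : GeneratedByPurePowers χ)
    (hf : f ∈ F.cocycles χ) {p : ℤ × ℤ} {i j : Fin F.n}
    (hi : ∃ k ∈ overlap i i, F.IsPole χ p k) (hj : ∃ k ∈ overlap j j, F.IsPole χ p k) :
    (f i j).coeff p = 0 := by
  -- Cocycles are antisymmetric.
  wlog hij : (i : ℕ) ≤ j generalizing i j
  · have h1 := this hj hi (by omega)
    have h2 := cocycle_add_apply hf i j i p
    have h3 := cocycle_add_apply hf i i i p
    rw [h1, add_zero] at h2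
    rw [h2]
    simpa using h3
  by_contra hne
  refine hne (cocycle_apply_eq_zero hf i j j.2 hij fun l h1 h2 => ?_)
  obtain ⟨b, hb, hbp⟩ := hi
  obtain ⟨c, hc, hcp⟩ := hj
  simp only [overlap, Set.inter_self, Set.mem_insert_iff, Set.mem_singleton_iff] at hb hc
  refine F.isPole_between hr hχ (fun u hu => ?_) (by omega) (by omega) (by omega) hbp hcp
  exact (F.mem_dualSheaf_iff.1 (hf.1 i j) p (Finsupp.mem_support_iff.2 hne) u hu).1

theorem mem_coboundaries (hr : 0 < r) (hχ : GeneratedByPurePowers χ) (hf : f ∈ F.cocycles χ) :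
    f ∈ F.coboundaries χ := by
  classical
  rcases Nat.eq_zero_or_pos F.n with hn | hn
  · exact ⟨0, fun _ => zero_mem _, fun i => absurd i.2 (by omega)⟩
  -- The base chart of degree `p` is one meeting a pole if there is any; otherwise chart `0` serves,
  -- as no chart imposes a pole condition.
  have hs : ∀ p : ℤ × ℤ, ∃ s : Fin F.n, ∀ i : Fin F.n,
      (∃ k ∈ overlap i i, F.IsPole χ p k) → ∃ k ∈ overlap s s, F.IsPole χ p k := by
    intro p
    by_cases h : ∃ s : Fin F.n, ∃ k ∈ overlap s s, F.IsPole χ p k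
    · exact ⟨h.choose, fun _ _ => h.choose_spec⟩
    · exact ⟨⟨0, hn⟩, fun i hi => absurd ⟨i, hi⟩ h⟩
  choose s hs using hs
  -- The base chart varies with `p`; the union of the supports over all possible bases is finite, so
  -- `g i` is still a Laurent polynomial.
  let g : Fin F.n → Laurent := fun i => AddMonoidAlgebra.ofCoeff <|
    Finsupp.onFinset (Finset.univ.biUnion fun j => (f j i).coeff.support)
      (fun p => (f (s p) i).coeff p) fun p hp => by
        rw [Finset.mem_biUnion]
        exact ⟨s p, Finset.mem_univ _, Finsupp.mem_support_iff.2 hp⟩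
  have hg : ∀ i p, (g i).coeff p = (f (s p) i).coeff p := fun i p => rfl
  refine ⟨g, fun i => F.mem_dualSheaf_iff.2 fun p hp u hu => ?_, fun i j => ?_⟩
  · rw [Finsupp.mem_support_iff, hg] at hp
    refine ⟨(F.mem_dualSheaf_iff.1 (hf.1 (s p) i) p (Finsupp.mem_support_iff.2 hp) u hu).1,
      fun k hk => ?_⟩
    by_contra! hlt
    have hi : ∃ k ∈ overlap i i, F.IsPole χ p k := ⟨k, hk, u, hu, hlt⟩
    exact hp (cocycle_apply_eq_zero_of_isPole hr hχ hf (hs p i hi) hi)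
  · ext p
    have : (g j - g i).coeff p = (g j).coeff p - (g i).coeff p := rfl
    rw [this, hg, hg, ← cocycle_add_apply hf (s p) i j, add_sub_cancel_left]

end Cech

end MinimalResolution

theorem isSpecial_of_generatedByPurePowers {r a : ℕ} (hr : 0 < r) {χ : Character r a}
    (hχ : GeneratedByPurePowers χ) : IsSpecial χ := by
  intro F
  rw [Submodule.Quotient.subsingleton_iff, eq_top_iff]
  exact fun f _ => MinimalResolution.mem_coboundaries hr hχ f.2

end CyclicQuotient

open CyclicQuotient in
theorem proposition3 (r a : ℕ) (hr : 0 < r) (hra : Nat.gcd r a = 1) :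
    (∀ (Γ : Set Mon) (X : Mon), IsGGraph r a Γ → IsSocle Γ X → IsSpecial (wt r a (X + xy))) ∧
      (∀ χ ∈ EC r a (1 + a), IsSpecial χ) := by
  refine ⟨fun Γ X hΓ hX =>
    isSpecial_of_generatedByPurePowers hr (generatedByPurePowers_of_socle hΓ hX), ?_⟩
  rintro _ ⟨_, ⟨Γ, X, hΓ, hX, rfl⟩, rfl⟩
  rw [chi_mul_wt]
  exact isSpecial_of_generatedByPurePowers hr (generatedByPurePowers_of_socle hΓ hX)
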